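/- **Conventions.** A signature $\sigma$ is a finite set of relation symbols $R$, each with an arity $\mathrm{ar}(R)\ge 1$. A (finite) $\sigma$-structure $\mathbf A$ consists of a finite set $A$ and a non-empty relation $R^{\mathbf A}\subseteq A^{\mathrm{ar}(R)}$ for each $R\in\sigma$. Its set of constraints is $\mathcal C_{\mathbf A}=\{R(\mathbf a): R\in\sigma,\ \mathbf a\in R^{\mathbf A}\}$, and $\{\mathbf a\}$ denotes the set of entries of a tuple $\mathbf a$. We write $\mathbf X\to\mathbf A$ if there is a homomorphism from $\mathbf X$ to $\mathbf A$, i.e. a map $h:X\to A$ with $h(\mathbf x)\in R^{\mathbf A}$ for all $R\in\sigma$ and $\mathbf x\in R^{\mathbf X}$; $\mathrm{CSP}(\mathbf A)$ is the problem of deciding, for an input $\sigma$-structure $\mathbf X$, whether $\mathbf X\to\mathbf A$. *Weisfeiler-Leman equivalence.* The factor graph of $\mathbf A$ is the bipartite graph on $A\cup\mathcal C_{\mathbf A}$ in which $a\in A$ and $R(\mathbf a)\in\mathcal C_{\mathbf A}$ are adjacent iff $a\in\{\mathbf a\}$, the edge having the label $(S,R)$ with $S=\{i: a_i=a\}$.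 For a node $v$ let $\delta_0^{\mathbf A}(v)$ be one of two fixed symbols telling whether $v$ is an element or a constraint, and for $j\ge 1$ let $\delta^{\mathbf A}_{j}(v)$ be the multiset of the pairs $(\ell_{\{v,w\}},\delta^{\mathbf A}_{j-1}(w))$, where $w$ ranges over the neighbours of $v$ and $\ell_{\{v,w\}}$ is the label of the edge $\{v,w\}$. Put $\delta^{\mathbf A}(v)=(\delta_0^{\mathbf A}(v),\delta_1^{\mathbf A}(v),\dots)$. Write $\mathbf A\equiv_1\mathbf B$ if the multisets $\{\{\delta^{\mathbf A}(v): v\in A\cup\mathcal C_{\mathbf A}\}\}$ and $\{\{\delta^{\mathbf B}(v): v\in B\cup\mathcal C_{\mathbf B}\}\}$ are equal. $\mathrm{CSP}(\mathbf A)$ is closed under $\equiv_1$-equivalence if for all $\sigma$-structures $\mathbf X_1\equiv_1\mathbf X_2$ we have $\mathbf X_1\to\mathbf A$ iff $\mathbf X_2\to\mathbf A$. *Linear programs.* $\mathrm{BLP}(\mathbf X,\mathbf A)$ has variables $p_x(a)\in[0,1]$ for $x\in X$, $a\in A$, and $p_{R(\mathbf x)}(\mathbf a)\in[0,1]$ for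 $R(\mathbf x)\in\mathcal C_{\mathbf X}$, $\mathbf a\in A^{\mathrm{ar}(R)}$, with the constraints - $\sum_{a\in A}p_x(a)=1$ for all $x\in X$; - $p_{x_i}(a)=\sum_{\mathbf a\in A^{\mathrm{ar}(R)},\,a_i=a}p_{R(\mathbf x)}(\mathbf a)$ for all $R(\mathbf x)\in\mathcal C_{\mathbf X}$, $1\le i\le \mathrm{ar}(R)$, $a\in A$; - $p_{R(\mathbf x)}(\mathbf a)=0$ whenever $\mathbf a\notin R^{\mathbf A}$. For $k\ge1$, $\mathrm{SA}^k(\mathbf X,\mathbf A)$ has variables $p_V(f)\in[0,1]$ for $V\subseteq X$ with $1\le|V|\le k$ and $f:V\to A$, and $p_{R(\mathbf x)}(f)\in[0,1]$ for $R(\mathbf x)\in\mathcal C_{\mathbf X}$ and $f:\{\mathbf x\}\to A$, with the constraints - $\sum_{f:V\to A}p_V(f)=1$ for all $V\subseteq X$ with $1\le|V|\le k$; - $p_U(f)=\sum_{g:V\to A,\,g|_U=f}p_V(g)$ for all $\emptyset\ne U\subseteq V\subseteq X$ with $|V|\le k$ and all $f:U\to A$; - $p_U(f)=\sum_{g:\{\mathbf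 x\}\to A,\,g|_U=f}p_{R(\mathbf x)}(g)$ for all $R(\mathbf x)\in\mathcal C_{\mathbf X}$, $\emptyset\neq U\subseteq\{\mathbf x\}$ with $|U|\le k$ and all $f:U\to A$; - $p_{R(\mathbf x)}(f)=0$ whenever $f(\mathbf x)\notin R^{\mathbf A}$. For $\mathrm L\in\{\mathrm{BLP},\mathrm{SA}^1\}$, $\mathrm L(\mathbf X,\mathbf A)$ is feasible if it has a rational solution, and $\mathrm L$ decides $\mathrm{CSP}(\mathbf A)$ if for every $\sigma$-structure $\mathbf X$, feasibility of $\mathrm L(\mathbf X,\mathbf A)$ implies $\mathbf X\to\mathbf A$. *Polymorphisms.* For $k\ge1$, a $k$-ary polymorphism of $\mathbf A$ is a map $f:A^k\to A$ such that for every $R\in\sigma$, applying $f$ coordinate-wise to any $k$ tuples of $R^{\mathbf A}$ gives a tuple of $R^{\mathbf A}$. It is symmetric if $f(a_1,\dots,a_k)=f(a_{\rho(1)},\dots,a_{\rho(k)})$ for all $a_1,\dots,a_k\in A$ and all permutations $\rho$ of $\{1,\dots,k\}$. **Theorem.** Let $\mathbf A$ be a finite $\sigma$-structure. The following are equivalent: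 1. $\mathrm{CSP}(\mathbf A)$ is closed under $\equiv_1$-equivalence; 2. $\mathrm{SA}^1$ decides $\mathrm{CSP}(\mathbf A)$; 3. $\mathrm{BLP}$ decides $\mathrm{CSP}(\mathbf A)$; 4. $\mathbf A$ has symmetric polymorphisms of all arities $k\ge1$. -/

import Mathlib

universe u

/-- A signature: finitely many relation symbols, each with a positive arity. -/
structure Signature where
  /-- The relation symbols. -/
  Sym : Type u
  /-- There are finitely many relation symbols. -/
  finite_sym : Finite Sym
  /-- The arity of a relation symbol. -/
  ar : Sym → ℕ
  /-- Arities are positive. -/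
  ar_pos : ∀ R, 0 < ar R

/-- A finite relational structure over `σ`: a finite universe together with a non-empty relation
of the prescribed arity for every relation symbol. -/
structure RelStr (σ : Signature.{u}) where
  /-- The universe of the structure. -/
  Carrier : Type u
  /-- The universe is finite. -/
  fintype_carrier : Fintype Carrier
  /-- The interpretation of the relation symbols. -/
  rel : (R : σ.Sym) → Set (Fin (σ.ar R) → Carrier)
  /-- All relations are non-empty. -/
  rel_nonempty : ∀ R, (rel R).Nonempty

instance Signature.instFiniteSym (σ : Signature.{u}) : Finite σ.Sym := σ.finite_sym

instance RelStr.instFintypeCarrier {σ : Signature.{u}} (A : RelStr σ) : Fintype A.Carrier :=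
  A.fintype_carrier

namespace RelStr

variable {σ : Signature.{u}}

/-- `h` is a homomorphism from `X` to `A`. -/
def IsHom (X A : RelStr σ) (h : X.Carrier → A.Carrier) : Prop :=
  ∀ (R : σ.Sym) (x : Fin (σ.ar R) → X.Carrier), x ∈ X.rel R → (fun i => h (x i)) ∈ A.rel R

/-- `X` is homomorphic to `A`, that is, `X` is a yes-instance of `CSP(A)`. -/
def HomTo (X A : RelStr σ) : Prop :=
  ∃ h : X.Carrier → A.Carrier, IsHom X A h

/-! ### Constraints and iterated degrees -/

/-- The constraints of `A`: the formal expressions `R(a)` with `a` in the interpretation of `R`. -/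
abbrev Con (A : RelStr σ) : Type u :=
  Σ R : σ.Sym, {a : Fin (σ.ar R) → A.Carrier // a ∈ A.rel R}

noncomputable instance instFintypeCon (A : RelStr σ) : Fintype A.Con := Fintype.ofFinite _

/-- The tuple `a` of a constraint `R(a)`. -/
def Con.tuple {A : RelStr σ} (c : A.Con) : Fin (σ.ar c.1) → A.Carrier := c.2.1

open Classical in
/-- The set of entries of the tuple of a constraint. -/
noncomputable def Con.scope {A : RelStr σ} (c : A.Con) : Finset A.Carrier :=
  Finset.univ.image c.tuple

theorem Con.tuple_mem_scope {A : RelStr σ} (c : A.Con) (i : Fin (σ.ar c.1)) :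
    c.tuple i ∈ c.scope := by
  classical
  exact Finset.mem_image_of_mem _ (Finset.mem_univ i)

/-- The labels `(S, R)` of the edges of factor graphs, where `S` is a set of positions of `R`. -/
abbrev Label (σ : Signature.{u}) : Type u := Σ R : σ.Sym, Finset (Fin (σ.ar R))

open Classical in
/-- The label `(S, R)` of the pair consisting of an element `a` and a constraint `R(t)`:
`S` is the set of positions at which `a` occurs in `t`. -/
noncomputable def label (A : RelStr σ) (a : A.Carrier) (c : A.Con) : Label σ :=
  ⟨c.1, Finset.univ.filter fun i => c.tuple i = a⟩

/-- The values taken by the `j`-th iterated degrees: two symbols for `j = 0`, and multisets of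
pairs consisting of a label and a value of level `j` at level `j + 1`. The values do not depend on
the structure, so that iterated degrees in different structures can be compared. -/
def Degree (σ : Signature.{u}) : ℕ → Type u
  | 0 => ULift Bool
  | j + 1 => Multiset (Label σ × Degree σ j)

open Classical in
/-- The `j`-th iterated degree of a node of the factor graph of `A`. The nodes are the elements
and the constraints of `A`; an element is adjacent to the constraints in whose scope it lies, and
the edge is labelled by `label`. At level `j + 1` we collect, with multiplicity, the labels of the
edges to the neighbours together with the `j`-th iterated degrees of these neighbours. -/
noncomputable def iterDegree (A : RelStr σ) : (j : ℕ) → A.Carrier ⊕ A.Con → Degree σ j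
  | 0, .inl _ => ULift.up false
  | 0, .inr _ => ULift.up true
  | j + 1, .inl a =>
      ((Finset.univ.filter fun c : A.Con => a ∈ c.scope).val.map
        fun c => (A.label a c, A.iterDegree j (.inr c)) :
        Multiset (Label σ × Degree σ j))
  | j + 1, .inr c =>
      (c.scope.val.map fun a => (A.label a c, A.iterDegree j (.inl a)) :
        Multiset (Label σ × Degree σ j))

/-- The iterated degree of a node of the factor graph: the sequence of all its `j`-th iterated
degrees. -/
noncomputable def degree (A : RelStr σ) (v : A.Carrier ⊕ A.Con) : (j : ℕ) → Degree σ j :=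
  fun j => A.iterDegree j v

/-- The iterated degree sequence of `A`: the multiset of the iterated degrees of all nodes of the
factor graph. -/
noncomputable def degreeSeq (A : RelStr σ) : Multiset ((j : ℕ) → Degree σ j) :=
  (Finset.univ : Finset (A.Carrier ⊕ A.Con)).val.map A.degree

/-- `A ≡₁ B`: the two structures have the same iterated degree sequence. -/
def WLEquiv (A B : RelStr σ) : Prop := A.degreeSeq = B.degreeSeq

/-- `CSP(A)` is closed under `≡₁`-equivalence. -/
def ClosedUnderWL (A : RelStr σ) : Prop :=
  ∀ X₁ X₂ : RelStr σ, WLEquiv X₁ X₂ → (HomTo X₁ A ↔ HomTo X₂ A)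

/-! ### The linear programs -/

open Classical in
/-- The assignment `p x a`, `q c a` of rational values to the variables `p_x(a)`, `p_{R(x)}(a)`
is a solution of the basic linear programming relaxation of the pair `(X, A)`. -/
structure IsBLPSolution (X A : RelStr σ) (p : X.Carrier → A.Carrier → ℚ)
    (q : (c : X.Con) → (Fin (σ.ar c.1) → A.Carrier) → ℚ) : Prop where
  mem_p : ∀ x a, p x a ∈ Set.Icc (0 : ℚ) 1
  mem_q : ∀ c a, q c a ∈ Set.Icc (0 : ℚ) 1
  sum_p : ∀ x, ∑ a, p x a = 1
  marginal : ∀ (c : X.Con) (i : Fin (σ.ar c.1)) (b : A.Carrier),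
    p (c.tuple i) b = ∑ a : Fin (σ.ar c.1) → A.Carrier with a i = b, q c a
  support : ∀ (c : X.Con) (a : Fin (σ.ar c.1) → A.Carrier), a ∉ A.rel c.1 → q c a = 0

/-- `BLP(X, A)` is feasible. -/
def BLPFeasible (X A : RelStr σ) : Prop :=
  ∃ (p : X.Carrier → A.Carrier → ℚ) (q : (c : X.Con) → (Fin (σ.ar c.1) → A.Carrier) → ℚ),
    IsBLPSolution X A p q

open Classical in
/-- The assignment of the rational values `p V f` to the variables `p_V(f)`, where `V` is a subset
of `X` with `1 ≤ |V| ≤ k` and `f : V → A`, and of the values `q c f` to the variables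
`p_{R(x)}(f)`, where `f : {x} → A`, is a solution of the `k`-th level of the Sherali-Adams
relaxation of the pair `(X, A)`. The values of `p` at sets `V` that violate `1 ≤ |V| ≤ k` are
irrelevant. -/
structure IsSASolution (k : ℕ) (X A : RelStr σ)
    (p : (V : Finset X.Carrier) → (V → A.Carrier) → ℚ)
    (q : (c : X.Con) → (c.scope → A.Carrier) → ℚ) : Prop where
  mem_p : ∀ V : Finset X.Carrier, V.Nonempty → V.card ≤ k →
    ∀ f : V → A.Carrier, p V f ∈ Set.Icc (0 : ℚ) 1
  mem_q : ∀ (c : X.Con) (f : c.scope → A.Carrier), q c f ∈ Set.Icc (0 : ℚ) 1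
  sum_p : ∀ V : Finset X.Carrier, V.Nonempty → V.card ≤ k → ∑ f : V → A.Carrier, p V f = 1
  marginal_p : ∀ (U V : Finset X.Carrier) (hUV : U ⊆ V), U.Nonempty → V.card ≤ k →
    ∀ f : U → A.Carrier,
      p U f = ∑ g : V → A.Carrier with Finset.restrict₂ (π := fun _ => A.Carrier) hUV g = f, p V g
  marginal_q : ∀ (c : X.Con) (U : Finset X.Carrier) (hU : U ⊆ c.scope), U.Nonempty → U.card ≤ k →
    ∀ f : U → A.Carrier,
      p U f =
        ∑ g : c.scope → A.Carrier with Finset.restrict₂ (π := fun _ => A.Carrier) hU g = f, q c g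
  support : ∀ (c : X.Con) (f : c.scope → A.Carrier),
    (fun i => f ⟨c.tuple i, c.tuple_mem_scope i⟩) ∉ A.rel c.1 → q c f = 0

/-- `SA^k(X, A)` is feasible. -/
def SAFeasible (k : ℕ) (X A : RelStr σ) : Prop :=
  ∃ (p : (V : Finset X.Carrier) → (V → A.Carrier) → ℚ)
    (q : (c : X.Con) → (c.scope → A.Carrier) → ℚ), IsSASolution k X A p q

/-- `SA^k` decides `CSP(A)`. -/
def SADecides (k : ℕ) (A : RelStr σ) : Prop :=
  ∀ X : RelStr σ, SAFeasible k X A → HomTo X A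

/-- `BLP` decides `CSP(A)`. -/
def BLPDecides (A : RelStr σ) : Prop :=
  ∀ X : RelStr σ, BLPFeasible X A → HomTo X A

/-! ### Symmetric polymorphisms -/

/-- The `k`-ary operation `f` is a polymorphism of `A`: applied coordinate-wise to `k` tuples from
a relation of `A`, it gives a tuple in that relation. -/
def IsPolymorphism (A : RelStr σ) {k : ℕ} (f : (Fin k → A.Carrier) → A.Carrier) : Prop :=
  ∀ (R : σ.Sym) (t : Fin k → Fin (σ.ar R) → A.Carrier),
    (∀ j, t j ∈ A.rel R) → (fun i => f fun j => t j i) ∈ A.rel R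

/-- The `k`-ary operation `f` is symmetric. -/
def IsSymmetricOp {α : Type u} {k : ℕ} (f : (Fin k → α) → α) : Prop :=
  ∀ (a : Fin k → α) (ρ : Equiv.Perm (Fin k)), f (fun j => a (ρ j)) = f a

/-- `A` has symmetric polymorphisms of all (positive) arities. -/
def HasSymmetricPolymorphisms (A : RelStr σ) : Prop :=
  ∀ k : ℕ, 1 ≤ k → ∃ f : (Fin k → A.Carrier) → A.Carrier, A.IsPolymorphism f ∧ IsSymmetricOp f

end RelStr

/-!
The implications are proved in a cycle.

*Closure under `≡₁` gives symmetric polymorphisms.* A `k`-ary symmetric polymorphism arises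
from any homomorphism to `A` from the structure on `Fin k → A` whose relations `SymRel A k R` hold
for the tuples of functions that can be permuted, entry by entry, into the columns of `k` tuples of `R`
(`exists_symmetric_polymorphism`). Many copies of this structure, with relations restricted to
tuples without repeated entries, form `symBlowup`; repeated entries are recovered by the pigeonhole
principle (`exists_homomorphism_of_blowup`). Without repeated entries, a `k`-fold cover may be
twisted by an arbitrary permutation at every position of every constraint, and no twist is visible
to the iterated degrees (`wlEquiv_cover`). If the twist consists of the permutations that witness
`SymRel`, then evaluation is a homomorphism to `A`; hence there also is one from the untwisted
cover, which consists of copies of `symBlowup`.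

*Symmetric polymorphisms make BLP decide.* A rational solution with common denominator `N` turns
into a homomorphism by applying an `N`-ary symmetric polymorphism to the list in which every value
occurs `N` times as often as its weight (`HasSymmetricPolymorphisms.blpDecides`).

*If BLP decides, then so does `SA¹`*, since `SA¹` is the stronger relaxation
(`SAFeasible.blpFeasible`).

*If `SA¹` decides, then the CSP is closed under `≡₁`.* Given `Y ≡₁ X` and a homomorphism `h` from
`Y` to `A`, the distributions of the values of `h` on the classes of equal iterated degree solve
`SA¹(X, A)` (`WLEquiv.saFeasible`). The marginals agree because taking the `i`-th entry spreads a
class of constraints evenly over a class of elements (`exists_card_conTwins_eq_mul`), and the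
weights fit into `SA¹` rather than only BLP because constraints of equal iterated degree have the
same pattern of repeated entries.
-/

namespace RelStr

variable {σ : Signature.{u}}

/-! ### Symmetric polymorphisms round BLP solutions -/

/-- Two functions on a finite type that take every value equally often differ by a permutation. -/
theorem exists_perm_comp_eq {ι α : Type*} [Fintype ι] [DecidableEq α] (u v : ι → α)
    (h : ∀ a, (Finset.univ.filter fun j => u j = a).card =
      (Finset.univ.filter fun j => v j = a).card) :
    ∃ ρ : Equiv.Perm ι, ∀ j, u (ρ j) = v j := by
  have e : ∀ a, Nonempty ({j // v j = a} ≃ {j // u j = a}) := fun a => by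
    rw [← Fintype.card_eq, Fintype.card_subtype, Fintype.card_subtype, h a]
  let E : ι ≃ ι := (Equiv.sigmaFiberEquiv v).symm.trans
    ((Equiv.sigmaCongrRight fun a => (e a).some).trans (Equiv.sigmaFiberEquiv u))
  exact ⟨E, fun j => ((e (v j)).some ⟨j, rfl⟩).2⟩

/-- A function on `Fin N` with prescribed fibre sizes. -/
theorem exists_fun_card_fiber {α : Type*} [Fintype α] [DecidableEq α] {N : ℕ} (w : α → ℕ)
    (hw : ∑ a, w a = N) :
    ∃ l : Fin N → α, ∀ a, (Finset.univ.filter fun j => l j = a).card = w a := by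
  have e : Fin N ≃ Σ a, Fin (w a) := Fintype.equivOfCardEq (by simp [hw])
  refine ⟨fun j => (e j).1, fun a => ?_⟩
  rw [← Fintype.card_subtype]
  rw [Fintype.card_congr (e.subtypeEquiv (q := fun s => s.1 = a) fun _ => Iff.rfl),
    Fintype.card_congr (Equiv.sigmaSubtype a), Fintype.card_fin]

/-- Finitely many nonnegative rationals have a common denominator. -/
theorem exists_common_denominator {ι : Type*} [Finite ι] (r : ι → ℚ) (hr : ∀ i, 0 ≤ r i) :
    ∃ N : ℕ, 0 < N ∧ ∃ n : ι → ℕ, ∀ i, r i * N = n i := by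
  classical
  cases nonempty_fintype ι
  refine ⟨∏ i, (r i).den, Finset.prod_pos fun i _ => (r i).den_pos,
    fun i => (r i).num.toNat * ∏ j ∈ Finset.univ.erase i, (r j).den, fun i => ?_⟩
  have h1 : (((r i).num.toNat : ℕ) : ℚ) = (r i).num := by
    exact_mod_cast Int.toNat_of_nonneg (Rat.num_nonneg.2 (hr i))
  rw [← Finset.mul_prod_erase _ _ (Finset.mem_univ i)]
  push_cast
  rw [h1, ← mul_assoc, Rat.mul_den_eq_num]

theorem IsBLPSolution.sum_q {X A : RelStr σ} {p : X.Carrier → A.Carrier → ℚ}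
    {q : (c : X.Con) → (Fin (σ.ar c.1) → A.Carrier) → ℚ} (h : IsBLPSolution X A p q)
    (c : X.Con) : ∑ a, q c a = 1 := by
  classical
  rw [← h.sum_p (c.tuple ⟨0, σ.ar_pos _⟩), ← Finset.sum_fiberwise (g := fun a => a ⟨0, σ.ar_pos _⟩)]
  refine Finset.sum_congr rfl fun b _ => ?_
  rw [h.marginal]

/-- After scaling a solution by a common denominator `N`, the `N`-ary symmetric polymorphism is
applied, at every variable `x`, to a list in which each `a` occurs `N * p x a` times. -/
theorem HasSymmetricPolymorphisms.blpDecides {A : RelStr σ} (hA : A.HasSymmetricPolymorphisms) :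
    A.BLPDecides := by
  classical
  rintro X ⟨p, q, h⟩
  obtain ⟨N, hN, n, hn⟩ := exists_common_denominator
    (ι := (X.Carrier × A.Carrier) ⊕ (Σ c : X.Con, Fin (σ.ar c.1) → A.Carrier))
    (Sum.elim (fun s => p s.1 s.2) fun s => q s.1 s.2)
    (by rintro (s | s); exacts [(h.mem_p _ _).1, (h.mem_q _ _).1])
  have hp : ∀ x a, p x a * N = n (.inl (x, a)) := fun x a => hn (.inl (x, a))
  have hq : ∀ c a, q c a * N = n (.inr ⟨c, a⟩) := fun c a => hn (.inr ⟨c, a⟩)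
  have hP : ∀ x, ∃ l : Fin N → A.Carrier, ∀ a,
      (Finset.univ.filter fun j => l j = a).card = n (.inl (x, a)) := fun x => by
    refine exists_fun_card_fiber _ ?_
    have := h.sum_p x
    apply_fun (· * (N : ℚ)) at this
    simp only [Finset.sum_mul, hp, one_mul] at this
    exact_mod_cast this
  have hQ : ∀ c, ∃ l : Fin N → (Fin (σ.ar c.1) → A.Carrier), ∀ a,
      (Finset.univ.filter fun j => l j = a).card = n (.inr ⟨c, a⟩) := fun c => by
    refine exists_fun_card_fiber (fun a => n (.inr ⟨c, a⟩)) ?_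
    have := h.sum_q c
    apply_fun (· * (N : ℚ)) at this
    simp only [Finset.sum_mul, hq, one_mul] at this
    exact_mod_cast this
  choose L hL using hP
  choose T hT using hQ
  obtain ⟨f, hf, hs⟩ := hA N hN
  refine ⟨fun x => f (L x), fun R x hx => ?_⟩
  let c : X.Con := ⟨R, x, hx⟩
  have hmem : ∀ j, T c j ∈ A.rel R := fun j => by
    by_contra hj
    have h0 : n (.inr ⟨c, T c j⟩) = 0 := by
      have := hq c (T c j)
      rw [h.support c _ hj, zero_mul] at this
      exact_mod_cast this.symm
    rw [← hT, Finset.card_eq_zero] at h0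
    exact Finset.notMem_empty j (h0 ▸ by simp)
  have key : ∀ i, f (L (x i)) = f fun j => T c j i := fun i => by
    obtain ⟨ρ, hρ⟩ := exists_perm_comp_eq (fun j => T c j i) (L (x i)) fun b => by
      rw [hL, Finset.card_eq_sum_card_fiberwise (f := T c)
        (t := Finset.univ.filter fun a : Fin (σ.ar R) → A.Carrier => a i = b)
        (fun j hj => by simpa using hj)]
      have := h.marginal c i b
      apply_fun (· * (N : ℚ)) at this
      simp only [Finset.sum_mul, hq, hp] at this
      have h2 : ∑ a : Fin (σ.ar R) → A.Carrier with a i = b, n (.inr ⟨c, a⟩) =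
        n (.inl (x i, b)) := by exact_mod_cast this.symm
      rw [← h2]
      refine Finset.sum_congr rfl fun a ha => ?_
      rw [← hT c a, Finset.filter_filter]
      congr 1
      ext j
      simp only [Finset.mem_filter, Finset.mem_univ, true_and] at ha ⊢
      exact ⟨fun h => h.2, fun h => ⟨h ▸ ha, h⟩⟩
    rw [← hs (fun j => T c j i) ρ]
    exact congrArg f (funext fun j => (hρ j).symm)
  simp only [key]
  exact hf R (T c) hmem

/-! ### Comparison of BLP with the first Sherali-Adams level -/

/-- The tuple of values of an assignment `f` of the scope of the constraint `c`. -/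
def Con.values {X : RelStr σ} {α : Type*} (c : X.Con) (f : c.scope → α) : Fin (σ.ar c.1) → α :=
  fun i => f ⟨c.tuple i, c.tuple_mem_scope i⟩

theorem Con.exists_tuple_eq {X : RelStr σ} (c : X.Con) {x : X.Carrier} (hx : x ∈ c.scope) :
    ∃ i, c.tuple i = x := by
  classical
  simpa [Con.scope] using hx

theorem Con.values_injective {X : RelStr σ} {α : Type*} (c : X.Con) :
    Function.Injective (c.values (α := α)) := by
  rintro f g h
  funext ⟨x, hx⟩
  obtain ⟨i, rfl⟩ := c.exists_tuple_eq hx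
  exact congrFun h i

theorem Con.exists_values_eq {X : RelStr σ} {α : Type*} (c : X.Con) (a : Fin (σ.ar c.1) → α)
    (h : ∀ i j, c.tuple i = c.tuple j → a i = a j) : ∃ f, c.values f = a := by
  choose i hi using fun x : c.scope => c.exists_tuple_eq x.2
  exact ⟨fun x => a (i x), funext fun j => h _ _ (hi ⟨c.tuple j, _⟩)⟩

theorem SAFeasible.blpFeasible {X A : RelStr σ} (h : SAFeasible 1 X A) : BLPFeasible X A := by
  classical
  obtain ⟨p, q, h⟩ := h
  refine ⟨fun x a => p {x} fun _ => a, fun c a => ∑ g with c.values g = a, q c g,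
    ⟨fun x a => h.mem_p _ (by simp) (by simp) _, fun c a => ?_, fun x => ?_, fun c i b => ?_,
      fun c a ha => ?_⟩⟩
  · by_cases ha : ∃ g, c.values g = a
    · obtain ⟨g, rfl⟩ := ha
      simp only [c.values_injective.eq_iff, Finset.filter_eq', Finset.mem_univ, if_true,
        Finset.sum_singleton]
      exact h.mem_q c g
    · rw [Finset.filter_false_of_mem fun g _ hg => ha ⟨g, hg⟩]
      simp
  · rw [← h.sum_p {x} (by simp) (by simp)]
    refine Fintype.sum_bijective (fun a _ => a) ⟨fun a b hab => ?_, fun f => ?_⟩ _ _ fun _ => rfl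
    · exact congrFun hab ⟨x, by simp⟩
    · refine ⟨f ⟨x, by simp⟩, funext fun ⟨y, hy⟩ => ?_⟩
      obtain rfl := Finset.mem_singleton.1 hy
      rfl
  · have hU : {c.tuple i} ⊆ c.scope := by simpa using c.tuple_mem_scope i
    rw [h.marginal_q c {c.tuple i} hU (by simp) (by simp)]
    have hfilter : ∀ g : c.scope → A.Carrier,
        Finset.restrict₂ (π := fun _ => A.Carrier) hU g = (fun _ => b) ↔ c.values g i = b :=
      fun g => by
        refine ⟨fun hg => congrFun hg ⟨c.tuple i, by simp⟩, fun hg => funext fun ⟨y, hy⟩ => ?_⟩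
        obtain rfl := Finset.mem_singleton.1 hy
        exact hg
    simp only [hfilter]
    rw [← Finset.sum_fiberwise_of_maps_to (g := c.values)
      (t := Finset.univ.filter fun a : Fin (σ.ar c.1) → A.Carrier => a i = b)
      (fun g hg => by simpa using hg)]
    refine Finset.sum_congr rfl fun a ha => ?_
    rw [Finset.filter_filter]
    refine Finset.sum_congr (Finset.filter_congr fun g _ => ?_) fun _ _ => rfl
    simp only [Finset.mem_filter, Finset.mem_univ, true_and] at ha
    exact ⟨fun h => h.2, fun h => ⟨h ▸ ha, h⟩⟩
  · refine Finset.sum_eq_zero fun g hg => h.support c g ?_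
    simp only [Finset.mem_filter, Finset.mem_univ, true_and] at hg
    subst hg
    exact ha

/-- A BLP solution whose weights `q c a` are concentrated on tuples `a` that respect the equalities
between the entries of `c` is a solution of the first Sherali-Adams level. -/
theorem IsBLPSolution.saFeasible {X A : RelStr σ} {p : X.Carrier → A.Carrier → ℚ}
    {q : (c : X.Con) → (Fin (σ.ar c.1) → A.Carrier) → ℚ} (h : IsBLPSolution X A p q)
    (hq : ∀ c a, q c a ≠ 0 → ∀ i j, c.tuple i = c.tuple j → a i = a j) : SAFeasible 1 X A := by
  classical
  refine ⟨fun V f => if hV : V.Nonempty then p hV.choose (f ⟨_, hV.choose_spec⟩) else 0,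
    fun c f => q c (c.values f), ?_⟩
  -- A nonempty set with at most one element is a singleton.
  have hsing : ∀ V : Finset X.Carrier, V.Nonempty → V.card ≤ 1 → ∃ x, V = {x} := fun V hV h1 =>
    Finset.card_eq_one.1 (le_antisymm h1 hV.card_pos)
  have hp : ∀ (x : X.Carrier) (f : ({x} : Finset X.Carrier) → A.Carrier),
      (if hV : ({x} : Finset X.Carrier).Nonempty then p hV.choose (f ⟨_, hV.choose_spec⟩) else 0) =
        p x (f ⟨x, by simp⟩) := fun x f => by
    have hV : ({x} : Finset X.Carrier).Nonempty := by simp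
    rw [dif_pos hV]
    have hx : hV.choose = x := Finset.mem_singleton.1 hV.choose_spec
    congr!
  refine ⟨fun V hV h1 f => ?_, fun c f => h.mem_q _ _, fun V hV h1 => ?_,
    fun U V hUV hU h1 f => ?_, fun c U hU hU0 h1 f => ?_, fun c f hf => h.support c _ hf⟩
  · obtain ⟨x, rfl⟩ := hsing V hV h1
    rw [hp]
    exact h.mem_p _ _
  · obtain ⟨x, rfl⟩ := hsing V hV h1
    simp only [hp]
    rw [← h.sum_p x]
    refine Fintype.sum_bijective (fun f => f ⟨x, by simp⟩)
      ⟨fun f g hfg => funext fun ⟨y, hy⟩ => ?_, fun a => ⟨fun _ => a, rfl⟩⟩ _ _ fun _ => rfl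
    obtain rfl := Finset.mem_singleton.1 hy
    exact hfg
  · obtain rfl : U = V := Finset.eq_of_subset_of_card_le hUV (h1.trans hU.card_pos)
    have : ∀ g : U → A.Carrier, Finset.restrict₂ (π := fun _ => A.Carrier) hUV g = g :=
      fun g => rfl
    simp only [this, Finset.filter_eq', Finset.mem_univ, if_true, Finset.sum_singleton]
  · obtain ⟨x, rfl⟩ := hsing U hU0 h1
    rw [hp]
    obtain ⟨i, rfl⟩ := c.exists_tuple_eq (Finset.singleton_subset_iff.1 hU)
    rw [h.marginal]
    have hfilter : ∀ g : c.scope → A.Carrier,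
        Finset.restrict₂ (π := fun _ => A.Carrier) hU g = f ↔
          c.values g i = f ⟨c.tuple i, by simp⟩ :=
      fun g => by
        refine ⟨fun hg => congrFun hg ⟨c.tuple i, by simp⟩, fun hg => funext fun ⟨y, hy⟩ => ?_⟩
        obtain rfl := Finset.mem_singleton.1 hy
        exact hg
    simp only [hfilter]
    symm
    refine Finset.sum_bij_ne_zero (fun g _ _ => c.values g) (fun g hg _ => by simpa using hg)
      (fun g _ _ g' _ _ hgg => c.values_injective hgg) (fun a ha ha0 => ?_) fun _ _ _ => rfl
    obtain ⟨g, rfl⟩ := c.exists_values_eq a (hq c a ha0)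
    exact ⟨g, by simpa using ha, ha0, rfl⟩

/-! ### Iterated degrees and equivalent instances -/

open Classical in
/-- The map recovering the `j`-th iterated degree of a node from its `(j + 1)`-st one. For
`j = 0` it recognises the constraints as the nodes that have a neighbour of element type. -/
noncomputable def truncDegree : (j : ℕ) → Degree σ (j + 1) → Degree σ j
  | 0, m => ULift.up (decide (∃ s ∈ (show Multiset (Label σ × Degree σ 0) from m),
      s.2 = ULift.up false))
  | j + 1, m => ((show Multiset (Label σ × Degree σ (j + 1)) from m).map
      fun s => (s.1, truncDegree j s.2) : Multiset (Label σ × Degree σ j))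

theorem Con.scope_nonempty {X : RelStr σ} (c : X.Con) : c.scope.Nonempty :=
  ⟨_, c.tuple_mem_scope ⟨0, σ.ar_pos _⟩⟩

theorem truncDegree_iterDegree (X : RelStr σ) (j : ℕ) (v : X.Carrier ⊕ X.Con) :
    truncDegree j (X.iterDegree (j + 1) v) = X.iterDegree j v := by
  classical
  induction j generalizing v with
  | zero =>
    rcases v with a | c
    · refine congrArg ULift.up (decide_eq_false ?_)
      rintro ⟨s, hs, h0⟩
      obtain ⟨c, -, rfl⟩ := Multiset.mem_map.1 hs
      exact Bool.noConfusion (congrArg ULift.down h0)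
    · obtain ⟨x, hx⟩ := c.scope_nonempty
      exact congrArg ULift.up (decide_eq_true ⟨_, Multiset.mem_map_of_mem _ hx, rfl⟩)
  | succ j ih =>
    rcases v with a | c
    · exact (Multiset.map_map _ _ _).trans (Multiset.map_congr rfl fun c _ => Prod.ext rfl (ih _))
    · exact (Multiset.map_map _ _ _).trans (Multiset.map_congr rfl fun a _ => Prod.ext rfl (ih _))

theorem iterDegree_eq_of_le {X Y : RelStr σ} {v : X.Carrier ⊕ X.Con} {w : Y.Carrier ⊕ Y.Con}
    {i j : ℕ} (hij : i ≤ j) (h : X.iterDegree j v = Y.iterDegree j w) :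
    X.iterDegree i v = Y.iterDegree i w := by
  induction hij with
  | refl => exact h
  | step _ ih =>
    refine ih ?_
    rw [← truncDegree_iterDegree, h, truncDegree_iterDegree]

/-- In a finite structure, one level of the iterated degrees suffices to decide which nodes have a
given iterated degree. -/
theorem exists_level {X Y : RelStr σ} (v : X.Carrier ⊕ X.Con) :
    ∃ j, ∀ w : Y.Carrier ⊕ Y.Con, Y.iterDegree j w = X.iterDegree j v ↔
      Y.degree w = X.degree v := by
  have h : ∀ w : Y.Carrier ⊕ Y.Con, ∃ j, Y.iterDegree j w = X.iterDegree j v →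
      Y.degree w = X.degree v := fun w => by
    by_cases hw : Y.degree w = X.degree v
    · exact ⟨0, fun _ => hw⟩
    · obtain ⟨j, hj⟩ := Function.ne_iff.1 hw
      exact ⟨j, fun h => absurd h hj⟩
  choose j hj using h
  exact ⟨Finset.univ.sup j, fun w =>
    ⟨fun h => hj w (iterDegree_eq_of_le (Finset.le_sup (Finset.mem_univ w)) h),
      fun h => congrFun h _⟩⟩

theorem mem_label_iff {X : RelStr σ} (c : X.Con) (x : X.Carrier) (i : Fin (σ.ar c.1)) :
    i ∈ (X.label x c).2 ↔ c.tuple i = x := by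
  classical
  unfold label
  exact Finset.mem_filter.trans (and_iff_right (Finset.mem_univ _))

/-- Constraints of the same iterated degree have, for every entry of one of them, an entry of the
other at the same positions, with the same `j`-th iterated degree. -/
theorem exists_label_eq {X Y : RelStr σ} {c : X.Con} {d : Y.Con}
    (h : X.degree (.inr c) = Y.degree (.inr d)) (j : ℕ) {x : X.Carrier} (hx : x ∈ c.scope) :
    ∃ y ∈ d.scope, Y.label y d = X.label x c ∧
      Y.iterDegree j (.inl y) = X.iterDegree j (.inl x) := by
  have h1 : X.iterDegree (j + 1) (.inr c) = Y.iterDegree (j + 1) (.inr d) := congrFun h (j + 1)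
  rw [iterDegree, iterDegree] at h1
  have h2 := Multiset.mem_map_of_mem
    (fun a => (X.label a c, X.iterDegree j (.inl a))) (show x ∈ c.scope.val from hx)
  rw [h1] at h2
  obtain ⟨y, hy, h3⟩ := Multiset.mem_map.1 h2
  exact ⟨y, hy, congrArg Prod.fst h3, congrArg Prod.snd h3⟩

theorem sym_eq_of_degree_eq {X Y : RelStr σ} {c : X.Con} {d : Y.Con}
    (h : X.degree (.inr c) = Y.degree (.inr d)) : c.1 = d.1 := by
  obtain ⟨x, hx⟩ := c.scope_nonempty
  obtain ⟨y, -, hl, -⟩ := exists_label_eq h 0 hx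
  exact congrArg Sigma.fst hl.symm

section SameSymbol

variable {X Y : RelStr σ} {c : X.Con} {t : {t : Fin (σ.ar c.1) → Y.Carrier // t ∈ Y.rel c.1}}

theorem label_eq_of_degree_eq (h : X.degree (.inr c) = Y.degree (.inr ⟨c.1, t⟩))
    (i : Fin (σ.ar c.1)) :
    Y.label (t.1 i) ⟨c.1, t⟩ = X.label (c.tuple i) c := by
  obtain ⟨y, hy, hl, -⟩ := exists_label_eq h 0 (c.tuple_mem_scope i)
  have h1 := (mem_label_iff c (c.tuple i) i).2 rfl
  have h2 : (Y.label y ⟨c.1, t⟩).2 = (X.label (c.tuple i) c).2 := eq_of_heq (Sigma.mk.inj_iff.1 hl).2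
  rw [← h2] at h1
  have h3 : t.1 i = y := (mem_label_iff (⟨c.1, t⟩ : Y.Con) y i).1 h1
  rw [h3, hl]

theorem tuple_eq_iff_of_degree_eq (h : X.degree (.inr c) = Y.degree (.inr ⟨c.1, t⟩))
    (i j : Fin (σ.ar c.1)) : t.1 i = t.1 j ↔ c.tuple i = c.tuple j := by
  have h1 := label_eq_of_degree_eq h j
  have h2 : (Y.label (t.1 j) ⟨c.1, t⟩).2 = (X.label (c.tuple j) c).2 :=
    eq_of_heq (Sigma.mk.inj_iff.1 h1).2
  rw [← mem_label_iff c, ← h2]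
  exact (mem_label_iff (⟨c.1, t⟩ : Y.Con) _ i).symm

theorem degree_entry_eq (h : X.degree (.inr c) = Y.degree (.inr ⟨c.1, t⟩))
    (i : Fin (σ.ar c.1)) : Y.degree (.inl (t.1 i)) = X.degree (.inl (c.tuple i)) := by
  funext j
  obtain ⟨y, hy, hl, hd⟩ := exists_label_eq h j (c.tuple_mem_scope i)
  have h1 := (mem_label_iff c (c.tuple i) i).2 rfl
  have h2 : (Y.label y ⟨c.1, t⟩).2 = (X.label (c.tuple i) c).2 := eq_of_heq (Sigma.mk.inj_iff.1 hl).2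
  rw [← h2] at h1
  have h3 : t.1 i = y := (mem_label_iff (⟨c.1, t⟩ : Y.Con) y i).1 h1
  rw [h3]
  exact hd

end SameSymbol

theorem WLEquiv.exists_degree_eq {X Y : RelStr σ} (h : WLEquiv X Y) (v : Y.Carrier ⊕ Y.Con) :
    ∃ w, X.degree w = Y.degree v := by
  have : Y.degree v ∈ X.degreeSeq := by
    rw [show X.degreeSeq = Y.degreeSeq from h]
    exact Multiset.mem_map_of_mem _ (Finset.mem_univ v)
  obtain ⟨w, -, hw⟩ := Multiset.mem_map.1 this
  exact ⟨w, hw⟩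

open Classical in
/-- The elements of `Y` that have the same iterated degree as the element `x` of `X`. -/
noncomputable def twins {X : RelStr σ} (Y : RelStr σ) (x : X.Carrier) : Finset Y.Carrier :=
  Finset.univ.filter fun y => Y.degree (.inl y) = X.degree (.inl x)

open Classical in
/-- The tuples of the constraints of `Y` that have the same iterated degree as the constraint `c`
of `X`. Such constraints have the same relation symbol as `c`. -/
noncomputable def conTwins {X : RelStr σ} (Y : RelStr σ) (c : X.Con) :
    Finset {t : Fin (σ.ar c.1) → Y.Carrier // t ∈ Y.rel c.1} :=
  Finset.univ.filter fun t => X.degree (.inr c) = Y.degree (.inr ⟨c.1, t⟩)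

section Twins

variable {X Y : RelStr σ}

theorem mem_twins {x : X.Carrier} {y : Y.Carrier} :
    y ∈ twins Y x ↔ Y.degree (.inl y) = X.degree (.inl x) := by
  simp [twins]

theorem mem_conTwins {c : X.Con} {t : {t : Fin (σ.ar c.1) → Y.Carrier // t ∈ Y.rel c.1}} :
    t ∈ conTwins Y c ↔ X.degree (.inr c) = Y.degree (.inr ⟨c.1, t⟩) := by
  simp [conTwins]

open Classical in
/-- The number of constraints with the iterated degree of `c` that have `y` as their `i`-th entry
is a multiplicity in some level of the iterated degree of `y`, so it depends only on that degree. -/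
theorem card_conTwins_through (c : X.Con) (i : Fin (σ.ar c.1))
    {y y' : Y.Carrier} (hy : Y.degree (.inl y) = Y.degree (.inl y')) :
    ((conTwins Y c).filter fun t => t.1 i = y).card =
      ((conTwins Y c).filter fun t => t.1 i = y').card := by
  obtain ⟨j, hj⟩ := exists_level (Y := Y) (.inr c : X.Carrier ⊕ X.Con)
  have key : ∀ y : Y.Carrier,
      ((conTwins Y c).filter fun t => t.1 i = y).card =
      Multiset.count (X.label (c.tuple i) c, X.iterDegree j (.inr c))
        (show Multiset (Label σ × Degree σ j) from Y.iterDegree (j + 1) (.inl y)) := fun y => by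
    rw [iterDegree, Multiset.count_map, ← Finset.filter_val, Finset.card_val, Finset.filter_filter]
    refine Finset.card_bij (fun t _ => ⟨c.1, t⟩) (fun t ht => ?_) (fun t _ t' _ h => ?_)
      fun d hd => ?_
    · simp only [Finset.mem_filter, Finset.mem_univ, true_and, mem_conTwins] at ht ⊢
      obtain ⟨h, rfl⟩ := ht
      refine ⟨Con.tuple_mem_scope (⟨c.1, t⟩ : Y.Con) i, Prod.ext ?_ ?_⟩
      · exact (label_eq_of_degree_eq h i).symm
      · exact congrFun h j
    · exact eq_of_heq (Sigma.mk.inj_iff.1 h).2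
    · simp only [Finset.mem_filter, Finset.mem_univ, true_and, Prod.mk.injEq] at hd
      obtain ⟨-, hl, hd⟩ := hd
      have h := ((hj _).1 hd.symm).symm
      obtain ⟨R, t⟩ := d
      obtain rfl : c.1 = R := sym_eq_of_degree_eq h
      refine ⟨t, Finset.mem_filter.2 ⟨mem_conTwins.2 h, ?_⟩, rfl⟩
      have h1 := (mem_label_iff c (c.tuple i) i).2 rfl
      have h2 : (X.label (c.tuple i) c).2 = (Y.label y ⟨c.1, t⟩).2 :=
        eq_of_heq (Sigma.mk.inj_iff.1 hl).2
      rw [h2] at h1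
      exact (mem_label_iff (⟨c.1, t⟩ : Y.Con) y i).1 h1
  rw [key, key]
  exact congrArg _ (congrFun hy (j + 1))

open Classical in
/-- Taking the `i`-th entry distributes the constraints of the iterated degree of `c` evenly over
the elements of the iterated degree of the `i`-th entry of `c`. -/
theorem exists_card_conTwins_eq_mul (c : X.Con) (i : Fin (σ.ar c.1)) :
    ∃ m : ℕ, ∀ P : Y.Carrier → Prop,
      ((conTwins Y c).filter fun t => P (t.1 i)).card =
        ((twins Y (c.tuple i)).filter P).card * m := by
  have hfib : ∀ t ∈ conTwins Y c, t.1 i ∈ twins Y (c.tuple i) := fun t ht =>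
    mem_twins.2 (degree_entry_eq (mem_conTwins.1 ht) i)
  obtain ⟨m, hm⟩ : ∃ m, ∀ y ∈ twins Y (c.tuple i),
      ((conTwins Y c).filter fun t => t.1 i = y).card = m := by
    rcases (twins Y (c.tuple i)).eq_empty_or_nonempty with h0 | ⟨y₀, hy₀⟩
    · exact ⟨0, by simp [h0]⟩
    · exact ⟨_, fun y hy => card_conTwins_through c i
        ((mem_twins.1 hy).trans (mem_twins.1 hy₀).symm)⟩
  refine ⟨m, fun P => ?_⟩
  rw [Finset.card_eq_sum_card_fiberwise (f := fun t => t.1 i)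
    (t := (twins Y (c.tuple i)).filter P)
    (fun t ht => by
      simp only [Finset.coe_filter, Set.mem_ofPred_eq] at ht ⊢
      exact ⟨hfib t ht.1, ht.2⟩), ← smul_eq_mul, ← Finset.sum_const]
  refine Finset.sum_congr rfl fun y hy => ?_
  rw [← hm y (Finset.mem_filter.1 hy).1, Finset.filter_filter]
  congr 1
  refine Finset.filter_congr fun t _ => ?_
  exact ⟨fun h => h.2, fun h => ⟨h ▸ (Finset.mem_filter.1 hy).2, h⟩⟩

theorem WLEquiv.card_twins_pos (h : WLEquiv Y X) (x : X.Carrier) : 0 < (twins Y x).card := by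
  obtain ⟨y | c, hw⟩ := h.exists_degree_eq (.inl x)
  · exact Finset.card_pos.2 ⟨y, mem_twins.2 hw⟩
  · exact Bool.noConfusion (congrArg ULift.down (congrFun hw 0))

theorem WLEquiv.card_conTwins_pos (h : WLEquiv Y X) (c : X.Con) : 0 < (conTwins Y c).card := by
  obtain ⟨y | ⟨R, t⟩, hw⟩ := h.exists_degree_eq (.inr c)
  · exact Bool.noConfusion (congrArg ULift.down (congrFun hw 0))
  · obtain rfl : c.1 = R := sym_eq_of_degree_eq hw.symm
    exact Finset.card_pos.2 ⟨t, mem_conTwins.2 hw.symm⟩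

end Twins

theorem card_filter_div_card_mem_Icc {α : Type*} (s : Finset α) (P : α → Prop) [DecidablePred P] :
    ((s.filter P).card : ℚ) / s.card ∈ Set.Icc (0 : ℚ) 1 :=
  ⟨by positivity, div_le_one_of_le₀ (by exact_mod_cast Finset.card_filter_le _ _) (by positivity)⟩

/-- If `Y` has a homomorphism `h` to `A` and `Y ≡₁ X`, then `SA¹(X, A)` has a solution: the
variables of an element or constraint `v` of `X` are given by the distribution of the values of `h`
on the elements or constraints of `Y` with the same iterated degree as `v`. -/
theorem WLEquiv.saFeasible {X Y A : RelStr σ} (hXY : WLEquiv Y X) (hY : HomTo Y A) :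
    SAFeasible 1 X A := by
  classical
  obtain ⟨h, hh⟩ := hY
  have hsol : IsBLPSolution X A
      (fun x a => ((twins Y x).filter fun y => h y = a).card / (twins Y x).card)
      (fun c a => ((conTwins Y c).filter fun t => (fun i => h (t.1 i)) = a).card /
        (conTwins Y c).card) := by
    refine ⟨fun x a => card_filter_div_card_mem_Icc _ _, fun c a => card_filter_div_card_mem_Icc _ _,
      fun x => ?_, fun c i b => ?_, fun c a ha => ?_⟩
    · rw [← Finset.sum_div, div_eq_one_iff_eq (by exact_mod_cast (hXY.card_twins_pos x).ne'),
        Finset.card_eq_sum_card_fiberwise (f := h) (t := Finset.univ) (fun _ _ => by simp)]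
      push_cast
      rfl
    · rw [← Finset.sum_div, ← Nat.cast_sum]
      have h1 : ∑ a : Fin (σ.ar c.1) → A.Carrier with a i = b,
          ((conTwins Y c).filter fun t => (fun i => h (t.1 i)) = a).card =
            ((conTwins Y c).filter fun t => h (t.1 i) = b).card := by
        rw [Finset.card_eq_sum_card_fiberwise (f := fun t i => h (t.1 i))
          (s := (conTwins Y c).filter fun t => h (t.1 i) = b)
          (t := Finset.univ.filter fun a : Fin (σ.ar c.1) → A.Carrier => a i = b)
          (fun t ht => by simpa using (Finset.mem_filter.1 ht).2)]
        refine Finset.sum_congr rfl fun a ha => ?_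
        rw [Finset.filter_filter]
        congr 1
        refine Finset.filter_congr fun t _ => ?_
        simp only [Finset.mem_filter, Finset.mem_univ, true_and] at ha
        exact ⟨fun h => ⟨(congrFun h i).trans ha, h⟩, fun h => h.2⟩
      obtain ⟨m, hm⟩ := exists_card_conTwins_eq_mul (Y := Y) c i
      have hcard : (conTwins Y c).card = (twins Y (c.tuple i)).card * m := by
        simpa using hm fun _ => True
      have hm0 : (m : ℚ) ≠ 0 := by
        have := hXY.card_conTwins_pos c
        rw [hcard] at this
        exact_mod_cast (pos_of_mul_pos_right this (Nat.zero_le _)).ne'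
      have hcard' : ((conTwins Y c).filter fun t => h (t.1 i) = b).card =
          ((twins Y (c.tuple i)).filter fun y => h y = b).card * m := by
        convert hm fun y => h y = b
      rw [h1, hcard, hcard', Nat.cast_mul, Nat.cast_mul, mul_div_mul_right _ _ hm0]
    · rw [Finset.filter_false_of_mem]
      · simp
      · rintro t - rfl
        exact ha (hh _ _ t.2)
  refine hsol.saFeasible fun c a hca i j hij => ?_
  have : ((conTwins Y c).filter fun t => (fun i => h (t.1 i)) = a).Nonempty := by
    rw [Finset.nonempty_iff_ne_empty]
    intro h0
    exact hca (by simp [h0])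
  obtain ⟨t, hta⟩ := this
  obtain ⟨ht, rfl⟩ := Finset.mem_filter.1 hta
  exact congrArg h ((tuple_eq_iff_of_degree_eq (mem_conTwins.1 ht) i j).2 hij)

theorem SADecides.closedUnderWL {A : RelStr σ} (hA : A.SADecides 1) : A.ClosedUnderWL :=
  fun _ _ h => ⟨fun h₁ => hA _ (h.saFeasible h₁), fun h₂ => hA _ (WLEquiv.saFeasible h.symm h₂)⟩

/-! ### Twisted covers -/

open Classical in
/-- The constraints that contain the element `x`. -/
noncomputable def star (X : RelStr σ) (x : X.Carrier) : Finset X.Con :=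
  Finset.univ.filter fun c : X.Con => x ∈ c.scope

theorem mem_star {X : RelStr σ} {x : X.Carrier} {c : X.Con} : c ∈ X.star x ↔ x ∈ c.scope := by
  simp [star]

theorem iterDegree_elem (X : RelStr σ) (x : X.Carrier) (n : ℕ) :
    X.iterDegree (n + 1) (.inl x) = ((X.star x).val.map
      fun c => (X.label x c, X.iterDegree n (.inr c)) : Multiset (Label σ × Degree σ n)) := by
  rw [iterDegree, star]

theorem iterDegree_con {X : RelStr σ} (c : X.Con) (hc : Function.Injective c.tuple) (n : ℕ) :
    X.iterDegree (n + 1) (.inr c) = ((Finset.univ : Finset (Fin (σ.ar c.1))).val.map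
      fun i => (X.label (c.tuple i) c, X.iterDegree n (.inl (c.tuple i))) :
      Multiset (Label σ × Degree σ n)) := by
  classical
  rw [iterDegree, Con.scope, Finset.image_val_of_injOn hc.injOn, Multiset.map_map]
  rfl

section Cover

variable (X : RelStr σ) (k : ℕ) [NeZero k]
  (ρ : (c : X.Con) → Fin (σ.ar c.1) → Equiv.Perm (Fin k))

/-- The `k`-fold cover of `X` twisted by `ρ`: every element of `X` is replaced by `k` copies, and
every constraint `c` by the `k` constraints that have at position `i` the copy number `ρ c i j` of
the `i`-th entry of `c`, for `j < k`. -/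
def cover : RelStr σ where
  Carrier := X.Carrier × Fin k
  fintype_carrier := inferInstance
  rel R := {t | ∃ (x : {x : Fin (σ.ar R) → X.Carrier // x ∈ X.rel R}) (j : Fin k),
    t = fun i => (x.1 i, ρ ⟨R, x⟩ i j)}
  rel_nonempty R := by
    obtain ⟨x, hx⟩ := X.rel_nonempty R
    exact ⟨_, ⟨x, hx⟩, 0, rfl⟩

/-- The `j`-th copy of the constraint `c` in a cover. -/
def coverCon (s : X.Con × Fin k) : (X.cover k ρ).Con :=
  ⟨s.1.1, fun i => (s.1.tuple i, ρ s.1 i s.2), s.1.2, s.2, rfl⟩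

variable {X k ρ}

theorem coverCon_bijective : Function.Bijective (coverCon X k ρ) := by
  constructor
  · rintro ⟨⟨R, x⟩, j⟩ ⟨⟨R', x'⟩, j'⟩ h
    obtain rfl : R = R' := congrArg Sigma.fst h
    have h1 := congrArg Subtype.val (eq_of_heq (Sigma.mk.inj_iff.1 h).2)
    obtain rfl : x = x' := Subtype.ext (funext fun i => congrArg Prod.fst (congrFun h1 i))
    obtain rfl : j = j' :=
      (ρ ⟨R, x⟩ ⟨0, σ.ar_pos R⟩).injective (congrArg Prod.snd (congrFun h1 _))
    rfl
  · rintro ⟨R, _, x, j, rfl⟩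
    exact ⟨(⟨R, x⟩, j), rfl⟩

theorem coverCon_tuple (c : X.Con) (j : Fin k) (i : Fin (σ.ar c.1)) :
    (coverCon X k ρ (c, j)).tuple i = (c.tuple i, ρ c i j) := rfl

/-- A cover of a structure without repeated entries in its constraints has the same iterated degrees
as the structure itself. -/
theorem iterDegree_cover (hX : ∀ c : X.Con, Function.Injective c.tuple) (n : ℕ) :
    (∀ s : X.Carrier × Fin k,
      (X.cover k ρ).iterDegree n (.inl s) = X.iterDegree n (.inl s.1)) ∧
    ∀ s : X.Con × Fin k,
      (X.cover k ρ).iterDegree n (.inr (coverCon X k ρ s)) = X.iterDegree n (.inr s.1) := by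
  classical
  have hlabel : ∀ (c : X.Con) (i : Fin (σ.ar c.1)) (j : Fin k),
      (X.cover k ρ).label (c.tuple i, ρ c i j) (coverCon X k ρ (c, j)) =
        X.label (c.tuple i) c := fun c i j => by
    refine Sigma.ext rfl (heq_of_eq (Finset.ext fun i' => ?_))
    refine (mem_label_iff (coverCon X k ρ (c, j)) _ i').trans
      (Iff.trans ?_ (mem_label_iff c _ i').symm)
    exact ⟨fun h => congrArg Prod.fst h, fun h => by rw [hX c h]; rfl⟩
  induction n with
  | zero => exact ⟨fun _ => rfl, fun _ => rfl⟩
  | succ n ih =>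
    constructor
    · rintro ⟨x, m⟩
      -- A constraint through `x` at position `i` has exactly one copy through `(x, m)`.
      refine (iterDegree_elem (X.cover k ρ) (x, m) n).trans
        (Eq.trans ?_ (iterDegree_elem X x n).symm)
      symm
      refine Multiset.map_eq_map_of_bij_of_nodup _ _ (Finset.nodup _) (Finset.nodup _)
        (fun c hc => coverCon X k ρ (c,
          (ρ c (c.exists_tuple_eq (mem_star.1 hc)).choose).symm m))
        ?_ ?_ ?_ ?_
      · intro c hc
        refine mem_star.2 ?_
        set i := (c.exists_tuple_eq (mem_star.1 hc)).choose
        have h := (c.exists_tuple_eq (mem_star.1 hc)).choose_spec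
        have := (coverCon X k ρ (c, (ρ c i).symm m)).tuple_mem_scope i
        rw [coverCon_tuple, Equiv.apply_symm_apply] at this
        rwa [← h]
      · intro c _ c' _ h
        exact congrArg Prod.fst (coverCon_bijective.1 h)
      · intro d hd
        obtain ⟨⟨c, j⟩, rfl⟩ := coverCon_bijective.2 d
        obtain ⟨i, hi⟩ := Con.exists_tuple_eq _ (mem_star.1 hd)
        obtain ⟨rfl, rfl⟩ := Prod.mk_inj.1 hi
        refine ⟨c, mem_star.2 (c.tuple_mem_scope i), ?_⟩
        have h := (c.exists_tuple_eq (c.tuple_mem_scope i)).choose_spec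
        rw [hX c h, Equiv.symm_apply_apply]
      · intro c hc
        have h := (c.exists_tuple_eq (mem_star.1 hc)).choose_spec
        set i := (c.exists_tuple_eq (mem_star.1 hc)).choose
        refine Prod.ext ?_ (ih.2 (c, _)).symm
        have := hlabel c i ((ρ c i).symm m)
        rw [Equiv.apply_symm_apply] at this
        rw [h] at this
        exact this.symm
    · rintro ⟨c, j⟩
      have hinj : Function.Injective (coverCon X k ρ (c, j)).tuple :=
        fun i i' h => hX c (congrArg Prod.fst h)
      rw [iterDegree_con _ hinj, iterDegree_con c (hX c)]
      exact Multiset.map_congr rfl fun i _ => Prod.ext (hlabel c i j) (ih.1 _)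

/-- All covers with the same number of sheets are equivalent, whatever the twist. -/
theorem wlEquiv_cover (hX : ∀ c : X.Con, Function.Injective c.tuple)
    (ρ' : (c : X.Con) → Fin (σ.ar c.1) → Equiv.Perm (Fin k)) :
    WLEquiv (X.cover k ρ) (X.cover k ρ') := by
  have key : ∀ ρ : (c : X.Con) → Fin (σ.ar c.1) → Equiv.Perm (Fin k), (X.cover k ρ).degreeSeq =
      (Finset.univ : Finset ((X.Carrier × Fin k) ⊕ (X.Con × Fin k))).val.map
        (Sum.elim (fun s => X.degree (.inl s.1)) fun s => X.degree (.inr s.1)) := fun ρ => by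
    let e : (X.Carrier × Fin k) ⊕ (X.Con × Fin k) ≃ (X.cover k ρ).Carrier ⊕ (X.cover k ρ).Con :=
      Equiv.sumCongr (Equiv.refl _) (Equiv.ofBijective _ (coverCon_bijective (ρ := ρ)))
    refine (Multiset.map_eq_map_of_bij_of_nodup _ _ (Finset.nodup _) (Finset.nodup _)
      (fun s _ => e s) (fun _ _ => Finset.mem_univ _) (fun _ _ _ _ h => e.injective h)
      (fun s _ => ⟨e.symm s, Finset.mem_univ _, e.apply_symm_apply s⟩) ?_).symm
    rintro (s | s) -
    · exact funext fun n => ((iterDegree_cover hX n).1 s).symm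
    · exact funext fun n => ((iterDegree_cover hX n).2 s).symm
  exact (key ρ).trans (key ρ').symm

end Cover

/-! ### Closure under equivalence gives symmetric polymorphisms -/

/-- The tuples `t 0, …, t (r - 1)` of functions `Fin k → A` that can be permuted, each one
separately, so that they become the columns of `k` tuples in `A.rel R`. -/
def SymRel (A : RelStr σ) (k : ℕ) (R : σ.Sym) (t : Fin (σ.ar R) → Fin k → A.Carrier) : Prop :=
  ∃ ρ : Fin (σ.ar R) → Equiv.Perm (Fin k), ∀ j, (fun i => t i (ρ i j)) ∈ A.rel R

/-- `N` copies of the structure with universe `Fin k → A` and relations `SymRel A k R`, where tuples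
relate arbitrary copies, but have no repeated entries. -/
def symBlowup (A : RelStr σ) (k N : ℕ) (hN : ∀ R, σ.ar R ≤ N) : RelStr σ where
  Carrier := (Fin k → A.Carrier) × Fin N
  fintype_carrier := by
    classical
    infer_instance
  rel R := {t | Function.Injective t ∧ A.SymRel k R fun i => (t i).1}
  rel_nonempty R := by
    obtain ⟨a, ha⟩ := A.rel_nonempty R
    exact ⟨fun i => (fun _ => a i, Fin.castLE (hN R) i),
      fun i j h => Fin.castLE_injective (hN R) (congrArg Prod.snd h), fun _ => 1, fun _ => ha⟩

/-- A homomorphism from the blow-up to `A` is constant on at least `M` copies of each element, by the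
pigeonhole principle. As `M` bounds the arities, a tuple with repeated entries has a lift to the
blow-up with distinct entries from these copies. -/
theorem exists_homomorphism_of_blowup {A : RelStr σ} {k M N : ℕ} (hM : ∀ R, σ.ar R ≤ M)
    (hN : ∀ R, σ.ar R ≤ N) (hMN : Fintype.card A.Carrier * M ≤ N) (hk : 0 < k)
    (h : HomTo (A.symBlowup k N hN) A) :
    ∃ g : (Fin k → A.Carrier) → A.Carrier,
      ∀ R t, A.SymRel k R t → (fun i => g (t i)) ∈ A.rel R := by
  classical
  obtain ⟨h, hh⟩ := h
  have hpig : ∀ a : Fin k → A.Carrier, ∃ b, M ≤ (Finset.univ.filter fun n => h (a, n) = b).card :=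
    fun a => by
      have : Nonempty A.Carrier := ⟨a ⟨0, hk⟩⟩
      exact Fintype.exists_le_card_fiber_of_mul_le_card (fun n : Fin N => h (a, n)) (by simpa)
  choose g hg using hpig
  refine ⟨g, fun R t ht => ?_⟩
  have hemb : ∀ a : Fin k → A.Carrier,
      ∃ e : Fin M → Fin N, Function.Injective e ∧ ∀ m, h (a, e m) = g a := fun a => by
    obtain ⟨e⟩ : Nonempty (Fin M ↪ {n : Fin N // h (a, n) = g a}) := by
      rw [Function.Embedding.nonempty_iff_card_le, Fintype.card_fin, Fintype.card_subtype]
      exact hg a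
    exact ⟨fun m => (e m).1, fun m m' hm => e.injective (Subtype.ext hm), fun m => (e m).2⟩
  choose e he heg using hemb
  have := hh R (fun i => (t i, e (t i) (Fin.castLE (hM R) i)))
    ⟨fun i j hij => by
      obtain ⟨h1, h2⟩ := Prod.mk_inj.1 hij
      rw [h1] at h2
      exact Fin.castLE_injective (hM R) (he _ h2), ht⟩
  simpa only [heg] using this

/-- A homomorphism from `Fin k → A` with the relations `SymRel` becomes symmetric when evaluated
only at representatives of the orbits of permutations. -/
theorem exists_symmetric_polymorphism {A : RelStr σ} {k : ℕ} (g : (Fin k → A.Carrier) → A.Carrier)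
    (hg : ∀ R t, A.SymRel k R t → (fun i => g (t i)) ∈ A.rel R) :
    ∃ f : (Fin k → A.Carrier) → A.Carrier, A.IsPolymorphism f ∧ IsSymmetricOp f := by
  let S : Setoid (Fin k → A.Carrier) :=
    { r := fun a b => ∃ π : Equiv.Perm (Fin k), ∀ j, a (π j) = b j
      iseqv := ⟨fun a => ⟨1, fun _ => rfl⟩,
        fun ⟨π, h⟩ => ⟨π.symm, fun j => by rw [← h, Equiv.apply_symm_apply]⟩,
        fun ⟨π, h⟩ ⟨τ, h'⟩ => ⟨τ.trans π, fun j => by rw [← h', ← h]; rfl⟩⟩ }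
  refine ⟨fun a => g (Quotient.mk S a).out, fun R t ht => ?_, fun a ρ => ?_⟩
  · choose π hπ using fun i => Quotient.mk_out (s := S) fun j => t j i
    exact hg R _ ⟨π, fun j => by simpa only [hπ] using ht j⟩
  · have : Quotient.mk S (fun j => a (ρ j)) = Quotient.mk S a :=
      (Quotient.sound (show S.r _ _ from ⟨ρ, fun _ => rfl⟩)).symm
    simp only [this]

/-- The trivial cover of `symBlowup` contains a copy of it, while the cover twisted by the
permutations that witness `SymRel` has a homomorphism to `A`, evaluation. -/
theorem ClosedUnderWL.hasSymmetricPolymorphisms {A : RelStr σ} (hA : A.ClosedUnderWL) :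
    A.HasSymmetricPolymorphisms := by
  classical
  intro k hk
  have : NeZero k := ⟨by omega⟩
  obtain ⟨M, hM⟩ : ∃ M, ∀ R, σ.ar R ≤ M := by
    obtain ⟨M, hM⟩ := Set.Finite.bddAbove (Set.finite_range σ.ar)
    exact ⟨M, fun R => hM ⟨R, rfl⟩⟩
  have hN : ∀ R, σ.ar R ≤ (Fintype.card A.Carrier + 1) * M := fun R =>
    (hM R).trans (Nat.le_mul_of_pos_left _ (Nat.succ_pos _))
  set X := A.symBlowup k _ hN
  have hX : ∀ c : X.Con, Function.Injective c.tuple ∧ A.SymRel k c.1 fun i => (c.tuple i).1 :=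
    fun c => c.2.2
  choose ρ hρ using fun c => (hX c).2
  have hev : HomTo (X.cover k ρ) A := ⟨fun s => s.1.1 s.2, by
    rintro R _ ⟨x, j, rfl⟩
    exact hρ ⟨R, x⟩ j⟩
  obtain ⟨h, hh⟩ := (hA (X.cover k ρ) (X.cover k fun _ _ => 1)
    (wlEquiv_cover (fun c => (hX c).1) _)).1 hev
  obtain ⟨g, hg⟩ := exists_homomorphism_of_blowup hM hN (Nat.mul_le_mul_right _ (Nat.le_succ _)) hk
    ⟨fun x => h (x, 0), fun R x hx => hh R _ ⟨⟨x, hx⟩, 0, rfl⟩⟩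
  exact exists_symmetric_polymorphism g hg

end RelStr

theorem theorem5p2 (σ : Signature.{u}) (A : RelStr σ) :
    List.TFAE
      [A.ClosedUnderWL,
       A.SADecides 1,
       A.BLPDecides,
       A.HasSymmetricPolymorphisms] := by
  tfae_have 1 → 4 := RelStr.ClosedUnderWL.hasSymmetricPolymorphisms
  tfae_have 4 → 3 := RelStr.HasSymmetricPolymorphisms.blpDecides
  tfae_have 3 → 2 := fun h X hX => h X hX.blpFeasible
  tfae_have 2 → 1 := RelStr.SADecides.closedUnderWL
  tfae_finish
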